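/- Let $V:(\mathbb{R}/\mathbb{Z})^2\to\mathbb{R}$ be a bounded measurable function that is (piecewise) Hölder continuous in the second variable, uniformly in the first: there are $\gamma>0$, $K<\infty$ and points $0=a_1<a_2<\cdots<a_m=1$ such that $$|V(x,y_1)-V(x,y_2)|\le K|y_1-y_2|^{\gamma}\qquad\text{for all }x\in\mathbb{R}/\mathbb{Z},\ 1\le i\le m-1,\ y_1,y_2\in[a_i,a_{i+1}].$$ Let $\omega\in\mathbb{R}$ and let $H$ be the Schrödinger operator $$(Hu)(x)=-u''(x)+V(x,\omega x)\,u(x)$$ on $L^2(\mathbb{R})$, with domain the set of $u\in L^2(\mathbb{R})$ such that $u$ is differentiable, $u'$ is locally absolutely continuous and $Hu\in L^2(\mathbb{R})$. Suppose that $$\beta(\omega)=\limsup_{k\to\infty}\frac{-\ln\|k\omega\|}{k}=\infty,$$ where $\|t\|=\operatorname{dist}(t,\mathbb{Z})$ and $-\ln 0=+\infty$. Then $H$ has no eigenvalues: there is no $E\in\mathbb{C}$ for which $Hu=Eu$ for some nonzero $u$ in the domain of $H$. -/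

import Mathlib

open MeasureTheory Filter

/-- `V : (ℝ/ℤ)² → ℝ` is piecewise `γ`-Hölder continuous with respect to the second variable:
it is (Lebesgue) measurable and bounded, and there are points `0 = a₀ < a₁ < ⋯ < aₙ = 1` such that
`V (x, ·)` is `γ`-Hölder on each closed interval `[aᵢ, aᵢ₊₁]`, with a constant uniform in `x`. -/
structure IsPiecewiseHolderSnd (γ : ℝ) (V : UnitAddCircle × UnitAddCircle → ℝ) : Prop where
  aemeasurable : AEMeasurable V (volume.prod volume)
  bounded : ∃ M : ℝ, ∀ p, |V p| ≤ M
  holder : ∃ (n : ℕ) (a : Fin (n + 1) → ℝ), StrictMono a ∧ a 0 = 0 ∧ a (Fin.last n) = 1 ∧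
    ∃ K : ℝ, ∀ (x : UnitAddCircle) (i : Fin n),
      ∀ y₁ ∈ Set.Icc (a i.castSucc) (a i.succ), ∀ y₂ ∈ Set.Icc (a i.castSucc) (a i.succ),
        |V (x, (y₁ : UnitAddCircle)) - V (x, (y₂ : UnitAddCircle))| ≤ K * |y₁ - y₂| ^ γ

/-- `β(ω) = limsup_{k → ∞} (-ln ‖kω‖) / k`, an extended real number, where `‖·‖`, the norm of
`ℝ/ℤ`, is the distance to the nearest integer and `-ln 0 = +∞`. -/
noncomputable def betaExponent (ω : ℝ) : EReal :=
  limsup (fun k : ℕ =>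
    -ENNReal.log (ENNReal.ofReal ‖((k * ω : ℝ) : UnitAddCircle)‖) / (k : EReal)) atTop

/-- The differential expression `(Hu)(x) = -u''(x) + V(x, ωx) u(x)`. -/
noncomputable def schrodinger (V : UnitAddCircle × UnitAddCircle → ℝ) (ω : ℝ) (u : ℝ → ℂ) :
    ℝ → ℂ :=
  fun x => -deriv (deriv u) x + (V ((x : UnitAddCircle), ((ω * x : ℝ) : UnitAddCircle)) : ℂ) * u x

/-- The (maximal) domain of `H` in `L²(ℝ)`: functions `u ∈ L²(ℝ)` which are differentiable with
locally absolutely continuous derivative and satisfy `Hu ∈ L²(ℝ)`. For bounded measurable `V` this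
is the Sobolev space `H²(ℝ)`, each class being given by its differentiable representative. -/
structure MemSchrodingerDomain (V : UnitAddCircle × UnitAddCircle → ℝ) (ω : ℝ) (u : ℝ → ℂ) :
    Prop where
  differentiable : Differentiable ℝ u
  deriv_absolutelyContinuous : ∀ s t : ℝ, AbsolutelyContinuousOnInterval (deriv u) s t
  memLp : MemLp u 2 volume
  memLp_schrodinger : MemLp (schrodinger V ω u) 2 volume

/-- `E` is an eigenvalue of `H` on `L²(ℝ)`: `Hu = Eu` for some `u ≠ 0` in the domain of `H`
(equalities in `L²(ℝ)`). -/
def IsSchrodingerEigenvalue (V : UnitAddCircle × UnitAddCircle → ℝ) (ω : ℝ) (E : ℂ) : Prop :=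
  ∃ u : ℝ → ℂ, MemSchrodingerDomain V ω u ∧ ¬ (u =ᵐ[volume] 0) ∧
    schrodinger V ω u =ᵐ[volume] fun x => E * u x

/-!
Since `β(ω) = ∞` and `V` is Hölder in the second variable, the potential `q(x) = V(x, ωx) - E` is
`exp (-L k)`-close to its translate by `k` for every `L` and infinitely many integers `k`. Let
`u'' = q u` with `u ∈ L²`. Both `u` and `u'` vanish at `±∞`, hence so does the Wronskian of `u` and
`u(· - k)`; its derivative is `(q(· - k) - q) u u(· - k)`, so it is `O(exp (-L k))` everywhere.
The function `w = u(x) u(· - k) - u(x - k) u` vanishes at `x`, `w'(x)` is that Wronskian, and `w`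
solves the equation up to a source of size `O(exp (-L k))`, so Gronwall's inequality on `[x, x + k]`
gives `u(x)² - u(x - k) u(x + k) = w(x + k) → 0` along such `k`. Hence `u(x) = 0`.
-/

open scoped NNReal Topology Interval

section AbsolutelyContinuous

variable {E : Type*} [NormedAddCommGroup E]

lemma absolutelyContinuousOnInterval_of_dist_le {X Y : Type*} [PseudoMetricSpace X]
    [PseudoMetricSpace Y] {f : ℝ → X} {g : ℝ → Y} {a b : ℝ}
    (hg : AbsolutelyContinuousOnInterval g a b)
    (h : ∀ x ∈ [[a, b]], ∀ y ∈ [[a, b]], dist (f x) (f y) ≤ dist (g x) (g y)) :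
    AbsolutelyContinuousOnInterval f a b := by
  rw [absolutelyContinuousOnInterval_iff] at hg ⊢
  intro ε hε
  obtain ⟨δ, hδ, hsum⟩ := hg ε hε
  exact ⟨δ, hδ, fun I hI hlen => (Finset.sum_le_sum fun i hi =>
    h _ (hI.1 i hi).1 _ (hI.1 i hi).2).trans_lt (hsum I hI hlen)⟩

variable [NormedSpace ℝ E]

lemma absolutelyContinuousOnInterval_integral {f : ℝ → E} {a b c : ℝ}
    (hf : IntervalIntegrable f volume a b) (hc : c ∈ [[a, b]]) :
    AbsolutelyContinuousOnInterval (fun x => ∫ t in c..x, f t) a b := by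
  refine absolutelyContinuousOnInterval_of_dist_le
    (hf.norm.absolutelyContinuousOnInterval_intervalIntegral hc) fun x hx y hy => ?_
  have integrable_to : ∀ z ∈ [[a, b]], IntervalIntegrable f volume c z := fun z hz =>
    hf.mono_set (Set.uIcc_subset_uIcc hc hz)
  rw [dist_eq_norm, dist_eq_norm,
    intervalIntegral.integral_interval_sub_left (integrable_to x hx) (integrable_to y hy),
    intervalIntegral.integral_interval_sub_left (integrable_to x hx).norm (integrable_to y hy).norm]
  exact intervalIntegral.norm_integral_le_abs_integral_norm

variable [CompleteSpace E]

lemma integral_eq_sub_of_absolutelyContinuousOnInterval {f f' : ℝ → E} {a b : ℝ}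
    (hf : AbsolutelyContinuousOnInterval f a b)
    (hderiv : ∀ᵐ x, x ∈ [[a, b]] → HasDerivAt f (f' x) x)
    (hint : IntervalIntegrable f' volume a b) : ∫ x in a..b, f' x = f b - f a := by
  have hsub : AbsolutelyContinuousOnInterval (fun x => f x - ∫ t in a..x, f' t) a b :=
    hf.sub (absolutelyContinuousOnInterval_integral hint Set.left_mem_uIcc)
  obtain ⟨c, hc⟩ := hsub.const_of_ae_hasDerivAt_zero <| by
    filter_upwards [hderiv, hint.ae_hasDerivAt_integral] with x hfx hIx hx
    simpa using (hfx hx).fun_sub (hIx hx a Set.left_mem_uIcc)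
  have ha : f a = c := by simpa using hc a Set.left_mem_uIcc
  rw [ha, ← hc b Set.right_mem_uIcc, sub_sub_cancel]

end AbsolutelyContinuous

section Gronwall

lemma gronwallBound_le_add_mul_exp {δ K ε x : ℝ} (hK : 1 ≤ K) (hε : 0 ≤ ε) :
    gronwallBound δ K ε x ≤ (δ + ε) * Real.exp (K * x) := by
  rw [gronwallBound_of_K_ne_0 (by linarith), add_mul]
  have hdiv : ε / K ≤ ε := div_le_self hε hK
  have hdiv0 : 0 ≤ ε / K := by positivity
  nlinarith [Real.exp_pos (K * x)]

lemma le_gronwallBound_of_le_add_integral {f : ℝ → ℝ} {δ K ε a b : ℝ} (hf : Continuous f)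
    (hK : 0 ≤ K) (hab : a ≤ b)
    (h : ∀ x ∈ Set.Icc a b, f x ≤ δ + ∫ t in a..x, (K * f t + ε)) :
    f b ≤ gronwallBound δ K ε (b - a) := by
  have hderiv : ∀ x, HasDerivAt (fun x => δ + ∫ t in a..x, (K * f t + ε)) (K * f x + ε) x :=
    fun x => (Continuous.integral_hasStrictDerivAt (by fun_prop) a x).hasDerivAt.const_add δ
  refine (h b ⟨hab, le_rfl⟩).trans (le_gronwallBound_of_liminf_deriv_right_le
    (fun x _ => (hderiv x).continuousAt.continuousWithinAt)
    (fun x _ r hr => (hderiv x).hasDerivWithinAt.liminf_right_slope_le hr) (by simp)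
    (fun x hx => ?_) b ⟨hab, le_rfl⟩)
  gcongr
  exact h x ⟨hx.1, hx.2.le⟩

end Gronwall

lemma sq_le_mul_intervalIntegral_sq {f : ℝ → ℝ} (hf : Continuous f) {c K x : ℝ} (hc : 0 ≤ c)
    (h : c ≤ K * ∫ y in x..x + 1, f y) : c ^ 2 ≤ K ^ 2 * ∫ y in x..x + 1, f y ^ 2 := by
  have hle : x ≤ x + 1 := by linarith
  have hprob : IsProbabilityMeasure (volume.restrict (Set.Ioc x (x + 1))) := ⟨by simp⟩
  have hjensen : (∫ y in x..x + 1, f y) ^ 2 ≤ ∫ y in x..x + 1, f y ^ 2 := by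
    rw [intervalIntegral.integral_of_le hle, intervalIntegral.integral_of_le hle]
    exact even_two.convexOn_pow.map_integral_le (continuous_pow 2).continuousOn isClosed_univ
      (by simp) ((hf.intervalIntegrable x (x + 1)).1) (((hf.pow 2).intervalIntegrable x (x + 1)).1)
  calc c ^ 2 ≤ (K * ∫ y in x..x + 1, f y) ^ 2 := by gcongr
    _ = K ^ 2 * (∫ y in x..x + 1, f y) ^ 2 := mul_pow _ _ _
    _ ≤ K ^ 2 * ∫ y in x..x + 1, f y ^ 2 := by gcongr

/-- `v` is the second derivative of `u` in the sense of the Sobolev space `W^{2,1}_loc(ℝ)`: `v` is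
integrable on bounded intervals and `u` is differentiable with `u'` a primitive of `v`. A solution
of `u'' = q u` with a merely measurable coefficient `q` is a function `u` such that
`HasWeakSecondDeriv u (fun x => q x * u x)`. -/
structure HasWeakSecondDeriv {E : Type*} [NormedAddCommGroup E] [NormedSpace ℝ E] (u v : ℝ → E) :
    Prop where
  differentiable : Differentiable ℝ u
  intervalIntegrable : ∀ a b, IntervalIntegrable v volume a b
  integral_eq_sub : ∀ a b, ∫ x in a..b, v x = deriv u b - deriv u a

namespace HasWeakSecondDeriv

section NormedSpace

variable {E : Type*} [NormedAddCommGroup E] [NormedSpace ℝ E] {u v u₁ v₁ : ℝ → E}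

lemma of_absolutelyContinuousOnInterval [CompleteSpace E] (hu : Differentiable ℝ u)
    (hac : ∀ a b, AbsolutelyContinuousOnInterval (deriv u) a b)
    (hv : ∀ a b, IntervalIntegrable v volume a b)
    (hderiv : ∀ᵐ x, HasDerivAt (deriv u) (v x) x) : HasWeakSecondDeriv u v :=
  ⟨hu, hv, fun a b => integral_eq_sub_of_absolutelyContinuousOnInterval (hac a b)
    (hderiv.mono fun _ hx _ => hx) (hv a b)⟩

lemma of_hasDerivAt [CompleteSpace E] {u' : ℝ → E} (hu : ∀ x, HasDerivAt u (u' x) x)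
    (hu' : ∀ x, HasDerivAt u' (v x) x) (hv : Continuous v) : HasWeakSecondDeriv u v := by
  refine ⟨fun x => (hu x).differentiableAt, hv.intervalIntegrable, fun a b => ?_⟩
  rw [funext fun x => (hu x).deriv]
  exact intervalIntegral.integral_eq_sub_of_hasDerivAt (fun x _ => hu' x)
    (hv.intervalIntegrable a b)

lemma sub (h : HasWeakSecondDeriv u v) (h₁ : HasWeakSecondDeriv u₁ v₁) :
    HasWeakSecondDeriv (fun x => u x - u₁ x) (fun x => v x - v₁ x) := by
  refine ⟨h.differentiable.sub h₁.differentiable,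
    fun a b => (h.intervalIntegrable a b).sub (h₁.intervalIntegrable a b), fun a b => ?_⟩
  have hderiv : ∀ x, deriv (fun x => u x - u₁ x) x = deriv u x - deriv u₁ x := fun x =>
    deriv_fun_sub (h.differentiable x) (h₁.differentiable x)
  rw [intervalIntegral.integral_sub (h.intervalIntegrable a b)
    (h₁.intervalIntegrable a b), h.integral_eq_sub, h₁.integral_eq_sub,
    hderiv, hderiv]
  abel

lemma const_smul {𝕜 : Type*} [RCLike 𝕜] [NormedSpace 𝕜 E] [SMulCommClass ℝ 𝕜 E] (c : 𝕜)
    (h : HasWeakSecondDeriv u v) :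
    HasWeakSecondDeriv (fun x => c • u x) (fun x => c • v x) := by
  refine ⟨h.differentiable.const_smul c,
    fun a b => (h.intervalIntegrable a b).smul c, fun a b => ?_⟩
  have hderiv : ∀ x, deriv (fun x => c • u x) x = c • deriv u x := fun x =>
    deriv_fun_const_smul c (h.differentiable x)
  rw [intervalIntegral.integral_smul, h.integral_eq_sub, hderiv, hderiv, smul_sub]

lemma comp_sub_const (h : HasWeakSecondDeriv u v) (T : ℝ) :
    HasWeakSecondDeriv (fun x => u (x - T)) (fun x => v (x - T)) where
  differentiable := h.differentiable.comp (differentiable_id.sub_const T)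
  intervalIntegrable a b := by
    simpa using (h.intervalIntegrable (a - T) (b - T)).comp_sub_right T
  integral_eq_sub a b := by
    rw [intervalIntegral.integral_comp_sub_right, h.integral_eq_sub, deriv_comp_sub_const,
      deriv_comp_sub_const]

lemma continuous (h : HasWeakSecondDeriv u v) : Continuous u := h.differentiable.continuous

lemma deriv_eq_add_integral (h : HasWeakSecondDeriv u v) (a : ℝ) :
    deriv u = fun x => deriv u a + ∫ t in a..x, v t :=
  funext fun x => by rw [h.integral_eq_sub, add_sub_cancel]

lemma continuous_deriv (h : HasWeakSecondDeriv u v) : Continuous (deriv u) := by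
  rw [h.deriv_eq_add_integral 0]
  exact continuous_const.add (intervalIntegral.continuous_primitive
    h.intervalIntegrable 0)

lemma contDiff (h : HasWeakSecondDeriv u v) : ContDiff ℝ 1 u :=
  contDiff_one_iff_deriv.2 ⟨h.differentiable, h.continuous_deriv⟩

lemma absolutelyContinuousOnInterval (h : HasWeakSecondDeriv u v) (a b : ℝ) :
    AbsolutelyContinuousOnInterval u a b :=
  h.contDiff.contDiffOn.absolutelyContinuousOnInterval

lemma absolutelyContinuousOnInterval_deriv (h : HasWeakSecondDeriv u v) (a b : ℝ) :
    AbsolutelyContinuousOnInterval (deriv u) a b := by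
  refine absolutelyContinuousOnInterval_of_dist_le
    (absolutelyContinuousOnInterval_integral (h.intervalIntegrable a b) Set.left_mem_uIcc)
    fun x _ y _ => ?_
  rw [h.integral_eq_sub, h.integral_eq_sub, dist_sub_right]

lemma ae_hasDerivAt_deriv [CompleteSpace E] (h : HasWeakSecondDeriv u v) (a b : ℝ) :
    ∀ᵐ x, x ∈ [[a, b]] → HasDerivAt (deriv u) (v x) x := by
  filter_upwards [(h.intervalIntegrable a b).ae_hasDerivAt_integral] with x hx hmem
  rw [h.deriv_eq_add_integral a]
  exact (hx hmem a Set.left_mem_uIcc).const_add _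

end NormedSpace

lemma integral_smul_sub_smul_eq {𝕜 E : Type*} [RCLike 𝕜] [NormedAddCommGroup E] [NormedSpace ℝ E]
    [NormedSpace 𝕜 E] [IsScalarTower ℝ 𝕜 E] [CompleteSpace E] {f v : ℝ → 𝕜} {g w : ℝ → E}
    (hf : HasWeakSecondDeriv f v) (hg : HasWeakSecondDeriv g w) (a b : ℝ) :
    ∫ x in a..b, (f x • w x - v x • g x) =
      (f b • deriv g b - deriv f b • g b) - (f a • deriv g a - deriv f a • g a) := by
  refine integral_eq_sub_of_absolutelyContinuousOnInterval
    (f := fun x => f x • deriv g x - deriv f x • g x)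
    (((hf.absolutelyContinuousOnInterval a b).fun_smul
      (hg.absolutelyContinuousOnInterval_deriv a b)).fun_sub
      ((hf.absolutelyContinuousOnInterval_deriv a b).fun_smul
        (hg.absolutelyContinuousOnInterval a b))) ?_ ?_
  · filter_upwards [hf.ae_hasDerivAt_deriv a b, hg.ae_hasDerivAt_deriv a b] with x hv hw hx
    have hproduct := ((hf.differentiable x).hasDerivAt.fun_smul (hw hx)).fun_sub
      ((hv hx).fun_smul (hg.differentiable x).hasDerivAt)
    exact hproduct.congr_deriv (by abel)
  · exact ((hg.intervalIntegrable a b).continuousOn_smul hf.continuous.continuousOn).sub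
      ((hf.intervalIntegrable a b).smul_continuousOn hg.continuous.continuousOn)

section Estimates

variable {E : Type*} [NormedAddCommGroup E] [NormedSpace ℝ E] [CompleteSpace E] {u v : ℝ → E}
  {C : ℝ}

-- Green's identity on `[x, x + 1]` against a cubic that vanishes to second order at `x + 1`.
lemma norm_smul_deriv_add_smul_le (h : HasWeakSecondDeriv u v) (hv : ∀ y, ‖v y‖ ≤ C * ‖u y‖)
    {a b : ℝ} (hcubic : ∀ s ∈ Set.Icc (0 : ℝ) 1, |s ^ 2 * (a + b * s)| ≤ 1)
    (hderiv₂ : ∀ s ∈ Set.Icc (0 : ℝ) 1, |2 * a + 6 * b * s| ≤ 6) (x : ℝ) :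
    ‖(a + b) • deriv u x + (2 * a + 3 * b) • u x‖ ≤ (C + 6) * ∫ y in x..x + 1, ‖u y‖ := by
  let φ : ℝ → ℝ := fun y => (x + 1 - y) ^ 2 * (a + b * (x + 1 - y))
  let φ' : ℝ → ℝ := fun y => -(x + 1 - y) * (2 * a + 3 * b * (x + 1 - y))
  let φ'' : ℝ → ℝ := fun y => 2 * a + 6 * b * (x + 1 - y)
  have hsub : ∀ y, HasDerivAt (fun y => x + 1 - y) (-1) y := fun y =>
    (hasDerivAt_id y).const_sub (x + 1)
  have hφ : ∀ y, HasDerivAt φ (φ' y) y := fun y =>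
    (((hsub y).fun_pow 2).fun_mul (((hsub y).const_mul b).const_add a)).congr_deriv (by
      simp only [φ']; ring)
  have hφ' : ∀ y, HasDerivAt φ' (φ'' y) y := fun y =>
    ((hsub y).fun_neg.fun_mul (((hsub y).const_mul (3 * b)).const_add (2 * a))).congr_deriv (by
      simp only [φ'']; ring)
  have hgreen : ∫ y in x..x + 1, (φ y • v y - φ'' y • u y) =
      -((a + b) • deriv u x + (2 * a + 3 * b) • u x) := by
    rw [(of_hasDerivAt hφ hφ' (by fun_prop)).integral_smul_sub_smul_eq h, (hφ x).deriv,
      (hφ (x + 1)).deriv]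
    simp only [φ, φ']
    module
  rw [← norm_neg, ← hgreen, ← intervalIntegral.integral_const_mul]
  refine intervalIntegral.norm_integral_le_of_norm_le (by linarith)
    (ae_of_all _ fun y hy => ?_) (h.continuous.norm.const_mul _ |>.intervalIntegrable _ _)
  have hs : x + 1 - y ∈ Set.Icc (0 : ℝ) 1 := ⟨by linarith [hy.2], by linarith [hy.1]⟩
  calc ‖φ y • v y - φ'' y • u y‖ ≤ |φ y| * ‖v y‖ + |φ'' y| * ‖u y‖ := by
        simpa only [norm_smul, Real.norm_eq_abs] using norm_sub_le (φ y • v y) (φ'' y • u y)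
    _ ≤ 1 * (C * ‖u y‖) + 6 * ‖u y‖ := by
        gcongr
        exacts [hcubic _ hs, hv y, hderiv₂ _ hs]
    _ = (C + 6) * ‖u y‖ := by ring

lemma norm_le_integral_norm (h : HasWeakSecondDeriv u v) (hv : ∀ y, ‖v y‖ ≤ C * ‖u y‖) (x : ℝ) :
    ‖u x‖ ≤ (C + 6) * ∫ y in x..x + 1, ‖u y‖ := by
  have hbound := h.norm_smul_deriv_add_smul_le hv (a := 1) (b := -1)
    (fun s ⟨hs₀, hs₁⟩ => abs_le.2 ⟨by nlinarith, by nlinarith⟩)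
    (fun s ⟨hs₀, hs₁⟩ => abs_le.2 ⟨by linarith, by linarith⟩) x
  norm_num at hbound
  exact hbound

lemma norm_deriv_le_integral_norm (h : HasWeakSecondDeriv u v) (hv : ∀ y, ‖v y‖ ≤ C * ‖u y‖)
    (x : ℝ) : ‖deriv u x‖ ≤ (C + 6) * ∫ y in x..x + 1, ‖u y‖ := by
  have hbound := h.norm_smul_deriv_add_smul_le hv (a := 3) (b := -2)
    (fun s ⟨hs₀, hs₁⟩ => abs_le.2 ⟨by nlinarith, by nlinarith [sq_nonneg (s - 1)]⟩)
    (fun s ⟨hs₀, hs₁⟩ => abs_le.2 ⟨by linarith, by linarith⟩) x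
  norm_num at hbound
  exact hbound

lemma sq_norm_le_integral_sq_norm (h : HasWeakSecondDeriv u v) (hv : ∀ y, ‖v y‖ ≤ C * ‖u y‖)
    (x : ℝ) : ‖u x‖ ^ 2 ≤ (C + 6) ^ 2 * ∫ y in x..x + 1, ‖u y‖ ^ 2 :=
  sq_le_mul_intervalIntegral_sq h.continuous.norm (norm_nonneg _)
    (h.norm_le_integral_norm hv x)

lemma sq_norm_deriv_le_integral_sq_norm (h : HasWeakSecondDeriv u v)
    (hv : ∀ y, ‖v y‖ ≤ C * ‖u y‖) (x : ℝ) :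
    ‖deriv u x‖ ^ 2 ≤ (C + 6) ^ 2 * ∫ y in x..x + 1, ‖u y‖ ^ 2 :=
  sq_le_mul_intervalIntegral_sq h.continuous.norm (norm_nonneg _)
    (h.norm_deriv_le_integral_norm hv x)

lemma norm_add_norm_deriv_le (h : HasWeakSecondDeriv u v) {ε : ℝ} (hC : 0 ≤ C) (hε : 0 ≤ ε)
    (hv : ∀ x, ‖v x‖ ≤ C * ‖u x‖ + ε) {a b : ℝ} (hab : a ≤ b) :
    ‖u b‖ + ‖deriv u b‖ ≤
      (‖u a‖ + ‖deriv u a‖ + ε) * Real.exp ((C + 1) * (b - a)) := by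
  have hcont := h.continuous
  have hcont' := h.continuous_deriv
  refine (le_gronwallBound_of_le_add_integral (f := fun x => ‖u x‖ + ‖deriv u x‖)
    (δ := ‖u a‖ + ‖deriv u a‖) (ε := ε) (K := C + 1) (by fun_prop) (by linarith) hab
    fun x hx => ?_).trans (gronwallBound_le_add_mul_exp (by linarith) hε)
  have hu : ‖u x - u a‖ ≤ ∫ t in a..x, ‖deriv u t‖ := by
    rw [← intervalIntegral.integral_deriv_eq_sub (fun t _ => h.differentiable t)
      (hcont'.intervalIntegrable a x)]
    exact intervalIntegral.norm_integral_le_integral_norm hx.1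
  have hu' : ‖deriv u x - deriv u a‖ ≤ ∫ t in a..x, (C * ‖u t‖ + ε) := by
    rw [← h.integral_eq_sub]
    exact intervalIntegral.norm_integral_le_of_norm_le hx.1 (ae_of_all _ fun t _ => hv t)
      (Continuous.intervalIntegrable (by fun_prop) _ _)
  have hsum : (∫ t in a..x, ‖deriv u t‖) + ∫ t in a..x, (C * ‖u t‖ + ε) ≤
      ∫ t in a..x, ((C + 1) * (‖u t‖ + ‖deriv u t‖) + ε) := by
    rw [← intervalIntegral.integral_add (Continuous.intervalIntegrable (by fun_prop) _ _)
      (Continuous.intervalIntegrable (by fun_prop) _ _)]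
    refine intervalIntegral.integral_mono_on hx.1 (Continuous.intervalIntegrable (by fun_prop) _ _)
      (Continuous.intervalIntegrable (by fun_prop) _ _) fun t _ => ?_
    nlinarith [norm_nonneg (u t), mul_nonneg hC (norm_nonneg (deriv u t))]
  linarith [norm_le_norm_add_norm_sub' (u x) (u a),
    norm_le_norm_add_norm_sub' (deriv u x) (deriv u a)]

end Estimates

end HasWeakSecondDeriv

lemma tendsto_cofinite_zero_of_sq_norm_le {E : Type*} [NormedAddCommGroup E] {g : ℝ → E}
    {f : ℝ → ℝ} {K : ℝ} (hf : Integrable f) (hg : ∀ x, ‖g x‖ ^ 2 ≤ K * ∫ y in x..x + 1, f y)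
    (x : ℝ) : Tendsto (fun n : ℤ => g (x + n)) cofinite (𝓝 0) := by
  have hlim := (hf.hasSum_intervalIntegral x).summable.tendsto_cofinite_zero.const_mul K
  rw [mul_zero] at hlim
  rw [tendsto_zero_iff_norm_tendsto_zero]
  have hsq := squeeze_zero (fun n : ℤ => sq_nonneg ‖g (x + n)‖) (fun n => hg (x + n)) hlim
  simpa [Real.sqrt_sq] using hsq.sqrt

lemma intervalIntegral_le_integral_of_nonneg {f : ℝ → ℝ} (hf : Integrable f) (hf₀ : 0 ≤ f)
    {a b : ℝ} (hab : a ≤ b) : ∫ x in a..b, f x ≤ ∫ x, f x := by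
  rw [intervalIntegral.integral_of_le hab]
  exact setIntegral_le_integral hf (ae_of_all _ hf₀)

lemma norm_mul_mul_sub_mul_mul_le {R : Type*} [SeminormedCommRing R] (a p s b q t : R) :
    ‖a * (p * s) - b * (q * t)‖ ≤ ‖q‖ * ‖a * s - b * t‖ + ‖p - q‖ * (‖a‖ * ‖s‖) :=
  calc ‖a * (p * s) - b * (q * t)‖ = ‖q * (a * s - b * t) + (p - q) * (a * s)‖ := by
        congr 1
        ring
    _ ≤ ‖q‖ * ‖a * s - b * t‖ + ‖p - q‖ * (‖a‖ * ‖s‖) :=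
        norm_add_le_of_le (norm_mul_le _ _) (norm_mul_le_of_le le_rfl (norm_mul_le _ _))

namespace HasWeakSecondDeriv

section SquareIntegrable

variable {E : Type*} [NormedAddCommGroup E] [NormedSpace ℝ E] [CompleteSpace E] {u v : ℝ → E}
  {C : ℝ}

lemma sq_norm_le_integral (h : HasWeakSecondDeriv u v) (hv : ∀ y, ‖v y‖ ≤ C * ‖u y‖)
    (hu : MemLp u 2) (x : ℝ) : ‖u x‖ ^ 2 ≤ (C + 6) ^ 2 * ∫ y, ‖u y‖ ^ 2 :=
  (h.sq_norm_le_integral_sq_norm hv x).trans <| by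
    gcongr
    exact intervalIntegral_le_integral_of_nonneg hu.norm.integrable_sq (fun _ => sq_nonneg _)
      (by linarith)

lemma tendsto_cofinite_zero (h : HasWeakSecondDeriv u v) (hv : ∀ y, ‖v y‖ ≤ C * ‖u y‖)
    (hu : MemLp u 2) (x : ℝ) : Tendsto (fun n : ℤ => u (x + n)) cofinite (𝓝 0) :=
  tendsto_cofinite_zero_of_sq_norm_le hu.norm.integrable_sq (h.sq_norm_le_integral_sq_norm hv) x

lemma tendsto_deriv_cofinite_zero (h : HasWeakSecondDeriv u v) (hv : ∀ y, ‖v y‖ ≤ C * ‖u y‖)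
    (hu : MemLp u 2) (x : ℝ) : Tendsto (fun n : ℤ => deriv u (x + n)) cofinite (𝓝 0) :=
  tendsto_cofinite_zero_of_sq_norm_le hu.norm.integrable_sq
    (h.sq_norm_deriv_le_integral_sq_norm hv) x

end SquareIntegrable

section Wronskian

variable {𝕜 : Type*} [RCLike 𝕜] {u v u₁ v₁ q : ℝ → 𝕜} {C δ : ℝ}

lemma norm_wronskian_le (h : HasWeakSecondDeriv u v) (h₁ : HasWeakSecondDeriv u₁ v₁)
    (hv : ∀ x, ‖v x‖ ≤ C * ‖u x‖) (hv₁ : ∀ x, ‖v₁ x‖ ≤ C * ‖u₁ x‖) (hu : MemLp u 2)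
    (hu₁ : MemLp u₁ 2) (hδ : 0 ≤ δ)
    (hle : ∀ x, ‖u x * v₁ x - v x * u₁ x‖ ≤ δ * (‖u x‖ * ‖u₁ x‖)) (x : ℝ) :
    ‖u x * deriv u₁ x - deriv u x * u₁ x‖ ≤
      δ * (((∫ y, ‖u y‖ ^ 2) + ∫ y, ‖u₁ y‖ ^ 2) / 2) := by
  let W : ℝ → 𝕜 := fun x => u x * deriv u₁ x - deriv u x * u₁ x
  have hint : Integrable fun y => δ * ((‖u y‖ ^ 2 + ‖u₁ y‖ ^ 2) / 2) :=
    ((hu.norm.integrable_sq.add hu₁.norm.integrable_sq).div_const 2).const_mul δ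
  have hvariation : ∀ n : ℕ, ‖W (x + n) - W x‖ ≤
      δ * (((∫ y, ‖u y‖ ^ 2) + ∫ y, ‖u₁ y‖ ^ 2) / 2) := fun n => by
    have hn : x ≤ x + n := le_add_of_nonneg_right n.cast_nonneg
    calc ‖W (x + n) - W x‖ = ‖∫ y in x..x + n, (u y * v₁ y - v y * u₁ y)‖ :=
          congrArg norm (h.integral_smul_sub_smul_eq h₁ x (x + n)).symm
      _ ≤ ∫ y in x..x + n, δ * ((‖u y‖ ^ 2 + ‖u₁ y‖ ^ 2) / 2) :=
          intervalIntegral.norm_integral_le_of_norm_le hn (ae_of_all _ fun y _ =>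
            (hle y).trans (by gcongr; linarith [two_mul_le_add_sq ‖u y‖ ‖u₁ y‖]))
            hint.intervalIntegrable
      _ ≤ ∫ y, δ * ((‖u y‖ ^ 2 + ‖u₁ y‖ ^ 2) / 2) :=
          intervalIntegral_le_integral_of_nonneg hint (fun _ => by positivity) hn
      _ = δ * (((∫ y, ‖u y‖ ^ 2) + ∫ y, ‖u₁ y‖ ^ 2) / 2) := by
          rw [integral_const_mul, integral_div,
            integral_add hu.norm.integrable_sq hu₁.norm.integrable_sq]
  have hdecay : Tendsto (fun n : ℤ => W (x + n)) cofinite (𝓝 0) := by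
    simpa using ((h.tendsto_cofinite_zero hv hu x).mul
      (h₁.tendsto_deriv_cofinite_zero hv₁ hu₁ x)).sub
      ((h.tendsto_deriv_cofinite_zero hv hu x).mul (h₁.tendsto_cofinite_zero hv₁ hu₁ x))
  have hdecay_nat : Tendsto (fun n : ℕ => W (x + n)) atTop (𝓝 0) := by
    simpa [Function.comp_def, Nat.cofinite_eq_atTop] using
      hdecay.comp (Nat.cast_injective (R := ℤ)).tendsto_cofinite
  simpa [W, norm_sub_rev] using
    le_of_tendsto ((hdecay_nat.sub_const (W x)).norm) (.of_forall hvariation)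

lemma norm_wronskian_comp_sub_const_le (h : HasWeakSecondDeriv u fun x => q x * u x)
    (hq : ∀ x, ‖q x‖ ≤ C) (hu : MemLp u 2) {T : ℝ} (hδ : 0 ≤ δ)
    (hle : ∀ x, ‖q (x - T) - q x‖ ≤ δ) (x : ℝ) :
    ‖u x * deriv (fun y => u (y - T)) x - deriv u x * u (x - T)‖ ≤ δ * ∫ y, ‖u y‖ ^ 2 := by
  have hv : ∀ y, ‖q y * u y‖ ≤ C * ‖u y‖ := fun y => norm_mul_le_of_le (hq y) le_rfl
  have hbound := h.norm_wronskian_le (h.comp_sub_const T) hv (fun y => hv (y - T)) hu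
    (hu.comp_measurePreserving (measurePreserving_sub_right volume T)) hδ (fun y => by
      rw [show u y * (q (y - T) * u (y - T)) - q y * u y * u (y - T) =
        (q (y - T) - q y) * (u y * u (y - T)) by ring, norm_mul, norm_mul (u y)]
      gcongr
      exact hle y) x
  rwa [integral_sub_right_eq_self (fun y => ‖u y‖ ^ 2) T, add_self_div_two] at hbound

lemma norm_sq_sub_mul_le (h : HasWeakSecondDeriv u fun x => q x * u x) (hq : ∀ x, ‖q x‖ ≤ C)
    (hu : MemLp u 2) {T : ℝ} (hT : 0 ≤ T) (hδ : 0 ≤ δ) (hle : ∀ x, ‖q (x - T) - q x‖ ≤ δ)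
    (x : ℝ) :
    ‖u x ^ 2 - u (x - T) * u (x + T)‖ ≤
      δ * (((C + 6) ^ 2 + 1) * ∫ y, ‖u y‖ ^ 2) * Real.exp ((C + 1) * T) := by
  set N := ∫ y, ‖u y‖ ^ 2
  have : 0 ≤ N := integral_nonneg fun y => sq_nonneg _
  have hC : 0 ≤ C := (norm_nonneg _).trans (hq 0)
  have hsup : ∀ y, ‖u y‖ ^ 2 ≤ (C + 6) ^ 2 * N :=
    h.sq_norm_le_integral (fun y => norm_mul_le_of_le (hq y) le_rfl) hu
  let w : ℝ → 𝕜 := fun y => u x • u (y - T) - u (x - T) • u y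
  have hw : HasWeakSecondDeriv w
      fun y => u x • (q (y - T) * u (y - T)) - u (x - T) • (q y * u y) :=
    ((h.comp_sub_const T).const_smul (u x)).sub (h.const_smul (u (x - T)))
  have hsource : ∀ y, ‖u x • (q (y - T) * u (y - T)) - u (x - T) • (q y * u y)‖ ≤
      C * ‖w y‖ + δ * ((C + 6) ^ 2 * N) := fun y =>
    (norm_mul_mul_sub_mul_mul_le (u x) (q (y - T)) (u (y - T)) (u (x - T)) (q y) (u y)).trans <| by
      gcongr ?_ * _ + ?_ * ?_
      · exact hq y
      · exact hle y
      · linarith [two_mul_le_add_sq ‖u x‖ ‖u (y - T)‖, hsup x, hsup (y - T)]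
  have hderiv : deriv w x = u x * deriv (fun y => u (y - T)) x - deriv u x * u (x - T) := by
    have hdiff := (((h.comp_sub_const T).differentiable x).hasDerivAt.const_smul (u x)).fun_sub
      ((h.differentiable x).hasDerivAt.const_smul (u (x - T)))
    exact hdiff.deriv.trans (by simp only [smul_eq_mul, mul_comm (deriv u x)])
  have hinitial : ‖w x‖ + ‖deriv w x‖ ≤ δ * N := by
    rw [hderiv, show w x = 0 by simp [w, mul_comm], norm_zero, zero_add]
    exact h.norm_wronskian_comp_sub_const_le hq hu hδ hle x
  calc ‖u x ^ 2 - u (x - T) * u (x + T)‖ = ‖w (x + T)‖ := by simp [w, sq]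
    _ ≤ ‖w (x + T)‖ + ‖deriv w (x + T)‖ := le_add_of_nonneg_right (norm_nonneg _)
    _ ≤ (‖w x‖ + ‖deriv w x‖ + δ * ((C + 6) ^ 2 * N)) * Real.exp ((C + 1) * (x + T - x)) :=
        hw.norm_add_norm_deriv_le hC (by positivity) hsource (by linarith)
    _ ≤ (δ * N + δ * ((C + 6) ^ 2 * N)) * Real.exp ((C + 1) * (x + T - x)) := by gcongr
    _ = δ * (((C + 6) ^ 2 + 1) * N) * Real.exp ((C + 1) * T) := by
        rw [add_sub_cancel_left]
        ring

end Wronskian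

end HasWeakSecondDeriv

/-- `q` is a (strong) Gordon potential: its translates by some arbitrarily large integers `k` are
within `exp (-L * k)` of it, for every rate `L`. -/
def IsGordonPotential {X : Type*} [PseudoMetricSpace X] (q : ℝ → X) : Prop :=
  ∀ L : ℝ, ∃ᶠ k : ℕ in atTop, ∀ x, dist (q (x + k)) (q x) ≤ Real.exp (-(L * k))

namespace IsGordonPotential

lemma comp_isometry {X Y : Type*} [PseudoMetricSpace X] [PseudoMetricSpace Y] {q : ℝ → X}
    {f : X → Y} (hq : IsGordonPotential q) (hf : Isometry f) :
    IsGordonPotential fun x => f (q x) := fun L =>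
  (hq L).mono fun _ hk x => (hf.dist_eq _ _).trans_le (hk x)

theorem eq_zero_of_memLp {𝕜 : Type*} [RCLike 𝕜] {q u : ℝ → 𝕜} {C : ℝ} (hq : IsGordonPotential q)
    (hC : ∀ x, ‖q x‖ ≤ C) (h : HasWeakSecondDeriv u fun x => q x * u x) (hu : MemLp u 2) :
    u = 0 := by
  funext x
  set A := ((C + 6) ^ 2 + 1) * ∫ y, ‖u y‖ ^ 2
  have hsq_le : ∃ᶠ k : ℕ in atTop,
      ‖u x ^ 2‖ ≤ ‖u (x - k) * u (x + k)‖ + A * Real.exp (-k) := by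
    refine (hq (C + 2)).mono fun k hk => ?_
    have hthree := h.norm_sq_sub_mul_le hC hu k.cast_nonneg (Real.exp_nonneg _) (fun y => by
      simpa only [sub_add_cancel, dist_eq_norm'] using hk (y - k)) x
    rw [mul_right_comm, ← Real.exp_add,
      show -((C + 2) * k) + (C + 1) * k = (-k : ℝ) by ring, mul_comm (Real.exp _)] at hthree
    linarith [norm_le_norm_add_norm_sub' (u x ^ 2) (u (x - k) * u (x + k))]
  have hdecay := h.tendsto_cofinite_zero (fun y => norm_mul_le_of_le (hC y) le_rfl) hu x
  have hright : Tendsto (fun k : ℕ => u (x + k)) atTop (𝓝 0) := by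
    simpa [Function.comp_def, Nat.cofinite_eq_atTop] using
      hdecay.comp (Nat.cast_injective (R := ℤ)).tendsto_cofinite
  have hleft : Tendsto (fun k : ℕ => u (x - k)) atTop (𝓝 0) := by
    simpa [Function.comp_def, Nat.cofinite_eq_atTop, sub_eq_add_neg] using
      hdecay.comp (neg_injective.comp (Nat.cast_injective (R := ℤ))).tendsto_cofinite
  have hlim : Tendsto (fun k : ℕ => ‖u (x - k) * u (x + k)‖ + A * Real.exp (-k)) atTop (𝓝 0) := by
    simpa using (hleft.mul hright).norm.add ((Real.tendsto_exp_neg_atTop_nhds_zero.comp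
      tendsto_natCast_atTop_atTop).const_mul A)
  simpa using ge_of_tendsto_of_frequently hlim hsq_le

end IsGordonPotential

section Holder

variable {X Y : Type*}

lemma holderOnWith_of_dist_le [PseudoMetricSpace X] [PseudoMetricSpace Y] {f : X → Y} {C r : ℝ≥0}
    {s : Set X} (h : ∀ x ∈ s, ∀ y ∈ s, dist (f x) (f y) ≤ C * dist x y ^ (r : ℝ)) :
    HolderOnWith C r f s := fun x hx y hy => by
  rw [edist_dist, edist_dist, ENNReal.ofReal_rpow_of_nonneg dist_nonneg r.coe_nonneg,
    ← ENNReal.ofReal_coe_nnreal, ← ENNReal.ofReal_mul C.coe_nonneg]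
  exact ENNReal.ofReal_le_ofReal (h x hx y hy)

variable [PseudoEMetricSpace Y] {C C₁ C₂ r : ℝ≥0} {a b c : ℝ}

lemma holderOnWith_Icc_of_Icc_of_Icc {f : ℝ → Y} (h₁ : HolderOnWith C₁ r f (Set.Icc a b))
    (h₂ : HolderOnWith C₂ r f (Set.Icc b c)) : HolderOnWith (C₁ + C₂) r f (Set.Icc a c) := by
  intro x hx y hy
  wlog hxy : x ≤ y generalizing x y
  · simpa only [edist_comm] using this y hy x hx (le_of_not_ge hxy)
  rcases le_total y b with hyb | hby
  · exact h₁.mono_const le_self_add x ⟨hx.1, hxy.trans hyb⟩ y ⟨hy.1, hyb⟩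
  rcases le_total b x with hbx | hxb
  · exact h₂.mono_const le_add_self x ⟨hbx, hx.2⟩ y ⟨hby, hy.2⟩
  have hmem : b ∈ [[x, y]] := Set.mem_uIcc_of_le hxb hby
  have hleft : edist x b ≤ edist x y := by
    simpa only [edist_dist] using ENNReal.ofReal_le_ofReal (Real.dist_left_le_of_mem_uIcc hmem)
  have hright : edist b y ≤ edist x y := by
    simpa only [edist_dist] using ENNReal.ofReal_le_ofReal (Real.dist_right_le_of_mem_uIcc hmem)
  calc edist (f x) (f y) ≤ edist (f x) (f b) + edist (f b) (f y) := edist_triangle _ _ _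
    _ ≤ C₁ * edist x y ^ (r : ℝ) + C₂ * edist x y ^ (r : ℝ) :=
        add_le_add (h₁.edist_le_of_le ⟨hx.1, hxb⟩ ⟨hx.1.trans hxb, le_rfl⟩ hleft)
          (h₂.edist_le_of_le ⟨le_rfl, hby.trans hy.2⟩ ⟨hby, hy.2⟩ hright)
    _ = (C₁ + C₂ : ℝ≥0) * edist x y ^ (r : ℝ) := by rw [ENNReal.coe_add, add_mul]

lemma holderOnWith_Icc_of_partition {f : ℝ → Y} {n : ℕ} {a : Fin (n + 1) → ℝ}
    (h : ∀ i : Fin n, HolderOnWith C r f (Set.Icc (a i.castSucc) (a i.succ))) (i : Fin (n + 1)) :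
    HolderOnWith (i * C) r f (Set.Icc (a 0) (a i)) := by
  induction i using Fin.induction with
  | zero => exact Set.Subsingleton.holderOnWith (by simp) _ _ _
  | succ i ih =>
    simpa [add_one_mul] using holderOnWith_Icc_of_Icc_of_Icc ih (h i)

lemma coe_intCast_unitAddCircle (m : ℤ) : ((m : ℝ) : UnitAddCircle) = 0 :=
  (AddCircle.coe_eq_zero_iff 1).2 ⟨m, by simp⟩

lemma exists_coe_eq_dist_eq (x y : UnitAddCircle) :
    ∃ s t : ℝ, (s : UnitAddCircle) = x ∧ (t : UnitAddCircle) = y ∧ dist s t = dist x y := by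
  obtain ⟨s, rfl⟩ := QuotientAddGroup.mk_surjective x
  obtain ⟨t, rfl⟩ := QuotientAddGroup.mk_surjective y
  refine ⟨s, t + round (s - t), rfl,
    by rw [AddCircle.coe_add, coe_intCast_unitAddCircle, add_zero], ?_⟩
  rw [dist_eq_norm (QuotientAddGroup.mk s : UnitAddCircle), Real.dist_eq, ← sub_sub]
  exact UnitAddCircle.norm_eq.symm

lemma holderWith_of_holderOnWith_Icc {g : UnitAddCircle → Y}
    (h : HolderOnWith C r (fun y : ℝ => g y) (Set.Icc 0 1)) : HolderWith (C + C) r g := by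
  have htranslate : ∀ m : ℤ, HolderOnWith C r (fun y : ℝ => g y) (Set.Icc m (m + 1)) :=
    fun m x hx y hy => by
      have hshift := h (x - m) ⟨by linarith [hx.1], by linarith [hx.2]⟩ (y - m)
        ⟨by linarith [hy.1], by linarith [hy.2]⟩
      simpa only [AddCircle.coe_sub, coe_intCast_unitAddCircle, sub_zero,
        edist_sub_right] using hshift
  intro x y
  obtain ⟨s, t, rfl, rfl, hdist⟩ := exists_coe_eq_dist_eq x y
  have hhalf : dist s t ≤ 1 / 2 := by
    rw [hdist, dist_eq_norm]
    simpa using AddCircle.norm_le_half_period (1 : ℝ) one_ne_zero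
  wlog hst : s ≤ t generalizing s t
  · simpa only [edist_comm] using
      this t s (by rwa [dist_comm, dist_comm (t : UnitAddCircle)]) (by rwa [dist_comm])
        (le_of_not_ge hst)
  rw [dist_comm, Real.dist_eq, abs_of_nonneg (sub_nonneg.2 hst)] at hhalf
  have hnext := htranslate (⌊s⌋ + 1)
  push_cast at hnext
  rw [edist_dist, ← hdist, ← edist_dist]
  exact holderOnWith_Icc_of_Icc_of_Icc (htranslate ⌊s⌋) hnext
    s ⟨Int.floor_le s, by linarith [Int.lt_floor_add_one s]⟩
    t ⟨(Int.floor_le s).trans hst, by linarith [Int.lt_floor_add_one s]⟩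

end Holder

lemma IsPiecewiseHolderSnd.exists_holderWith {γ : ℝ≥0} {V : UnitAddCircle × UnitAddCircle → ℝ}
    (hV : IsPiecewiseHolderSnd γ V) : ∃ K : ℝ≥0, ∀ x, HolderWith K γ fun y => V (x, y) := by
  obtain ⟨n, a, -, ha₀, ha₁, K, hK⟩ := hV.holder
  refine ⟨n * K.toNNReal + n * K.toNNReal, fun x => holderWith_of_holderOnWith_Icc ?_⟩
  have hpiece : ∀ i : Fin n, HolderOnWith K.toNNReal γ (fun y : ℝ => V (x, y))
      (Set.Icc (a i.castSucc) (a i.succ)) := fun i =>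
    holderOnWith_of_dist_le fun y₁ hy₁ y₂ hy₂ => (hK x i y₁ hy₁ y₂ hy₂).trans <| by
      rw [Real.dist_eq]
      gcongr
      exact Real.le_coe_toNNReal K
  simpa [ha₀, ha₁] using holderOnWith_Icc_of_partition hpiece (Fin.last n)

lemma frequently_norm_le_exp_of_betaExponent_eq_top {ω : ℝ} (hω : betaExponent ω = ⊤) (L : ℝ) :
    ∃ᶠ k : ℕ in atTop, ‖((k * ω : ℝ) : UnitAddCircle)‖ ≤ Real.exp (-(L * k)) := by
  have hfreq := frequently_lt_of_lt_limsup (h := hω ▸ EReal.coe_lt_top L)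
  refine (hfreq.and_eventually (eventually_gt_atTop 0)).mono fun k ⟨hlt, hk⟩ => ?_
  rcases (norm_nonneg ((k * ω : ℝ) : UnitAddCircle)).eq_or_lt with hzero | hpos
  · exact hzero ▸ (Real.exp_pos _).le
  rw [EReal.lt_div_iff (mod_cast hk) (EReal.natCast_ne_top k),
    ENNReal.log_pos_real' (by rwa [ENNReal.toReal_ofReal hpos.le]),
    ENNReal.toReal_ofReal hpos.le] at hlt
  have hlog : L * k < -Real.log ‖((k * ω : ℝ) : UnitAddCircle)‖ := mod_cast hlt
  exact (Real.log_le_iff_le_exp hpos).1 (by linarith)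

lemma isGordonPotential_of_holderWith {X : Type*} [PseudoMetricSpace X]
    {W : UnitAddCircle × UnitAddCircle → X} {K r : ℝ≥0} (hr : 0 < r)
    (hW : ∀ x, HolderWith K r fun y => W (x, y)) {ω : ℝ} (hω : betaExponent ω = ⊤) :
    IsGordonPotential fun x : ℝ => W (x, (ω * x : ℝ)) := fun L => by
  have hK : ∀ᶠ k : ℕ in atTop, (K : ℝ) ≤ Real.exp k :=
    (Real.tendsto_exp_atTop.comp tendsto_natCast_atTop_atTop).eventually_ge_atTop _
  refine ((frequently_norm_le_exp_of_betaExponent_eq_top hω ((L + 1) / r)).and_eventually hK).mono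
    fun k ⟨hk, hKk⟩ x => ?_
  have hfst : ((x + k : ℝ) : UnitAddCircle) = x := by
    rw [AddCircle.coe_add, ← Int.cast_natCast, coe_intCast_unitAddCircle, add_zero]
  have hsnd : dist ((ω * (x + k) : ℝ) : UnitAddCircle) (ω * x : ℝ) =
      ‖((k * ω : ℝ) : UnitAddCircle)‖ := by
    rw [dist_eq_norm, ← AddCircle.coe_sub, mul_add, add_sub_cancel_left, mul_comm]
  have : (0 : ℝ) < r := hr
  calc dist (W ((x + k : ℝ), (ω * (x + k) : ℝ))) (W (x, (ω * x : ℝ)))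
      ≤ K * ‖((k * ω : ℝ) : UnitAddCircle)‖ ^ (r : ℝ) := by
        rw [hfst, ← hsnd]
        exact (hW x).dist_le _ _
    _ ≤ Real.exp k * Real.exp (-((L + 1) / r * k)) ^ (r : ℝ) := by gcongr
    _ = Real.exp (-(L * k)) := by
        rw [← Real.exp_mul, ← Real.exp_add]
        congr 1
        field_simp
        ring

lemma ae_differentiableAt_of_absolutelyContinuousOnInterval {E : Type*} [NormedAddCommGroup E]
    [NormedSpace ℝ E] [FiniteDimensional ℝ E] {f : ℝ → E}
    (hf : ∀ a b, AbsolutelyContinuousOnInterval f a b) : ∀ᵐ x, DifferentiableAt ℝ f x := by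
  have hlocal : ∀ n : ℕ, ∀ᵐ x, x ∈ [[(-n : ℝ), n]] → DifferentiableAt ℝ f x := fun n =>
    (hf _ _).boundedVariationOn.ae_differentiableAt_of_mem_uIcc
  filter_upwards [ae_all_iff.2 hlocal] with x hx
  obtain ⟨n, hn⟩ := exists_nat_ge |x|
  exact hx n (Set.mem_uIcc_of_le (neg_le_of_abs_le hn) (le_of_abs_le hn))

lemma MemSchrodingerDomain.hasWeakSecondDeriv {V : UnitAddCircle × UnitAddCircle → ℝ} {M ω : ℝ}
    {E : ℂ} {u : ℝ → ℂ} (hu : MemSchrodingerDomain V ω u) (hM : ∀ p, |V p| ≤ M)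
    (heigen : schrodinger V ω u =ᵐ[volume] fun x => E * u x) :
    HasWeakSecondDeriv u fun x => ((V (x, (ω * x : ℝ)) : ℂ) - E) * u x := by
  have hderiv : ∀ᵐ x : ℝ, HasDerivAt (deriv u) (((V (x, (ω * x : ℝ)) : ℂ) - E) * u x) x := by
    filter_upwards [ae_differentiableAt_of_absolutelyContinuousOnInterval
      hu.deriv_absolutelyContinuous, heigen] with x hdiff heq
    refine hdiff.hasDerivAt.congr_deriv ?_
    rw [schrodinger] at heq
    linear_combination -heq
  have hmeas : AEStronglyMeasurable fun x : ℝ => ((V (x, (ω * x : ℝ)) : ℂ) - E) * u x :=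
    (stronglyMeasurable_deriv (deriv u)).aestronglyMeasurable.congr
      (hderiv.mono fun x hx => hx.deriv)
  refine .of_absolutelyContinuousOnInterval hu.differentiable hu.deriv_absolutelyContinuous
    (fun a b => ?_) hderiv
  exact ((hu.differentiable.continuous.norm.const_mul (M + ‖E‖)).intervalIntegrable a b).mono_fun'
    hmeas.restrict (ae_of_all _ fun x => norm_mul_le_of_le (norm_sub_le_of_le (by simpa using hM _)
      le_rfl) le_rfl)

theorem mainTheorem2_general {V : UnitAddCircle × UnitAddCircle → ℝ} {M : ℝ}
    (hM : ∀ p, |V p| ≤ M) {K r : ℝ≥0} (hr : 0 < r) (hV : ∀ x, HolderWith K r fun y => V (x, y))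
    {ω : ℝ} (hω : betaExponent ω = ⊤) (E : ℂ) : ¬ IsSchrodingerEigenvalue V ω E := by
  rintro ⟨u, hu, hne, heigen⟩
  have hisometry : Isometry fun t : ℝ => (t : ℂ) - E :=
    .of_dist_eq fun s t => by rw [dist_sub_right, Complex.isometry_ofReal.dist_eq]
  have hgordon := (isGordonPotential_of_holderWith hr hV hω).comp_isometry hisometry
  have hbound : ∀ x : ℝ, ‖(V (x, (ω * x : ℝ)) : ℂ) - E‖ ≤ M + ‖E‖ := fun x =>
    norm_sub_le_of_le (by simpa using hM _) le_rfl
  have hzero : u = 0 :=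
    hgordon.eq_zero_of_memLp hbound (hu.hasWeakSecondDeriv hM heigen) hu.memLp
  exact hne hzero.eventuallyEq

theorem mainTheorem2 (V : UnitAddCircle × UnitAddCircle → ℝ) (γ : ℝ) (hγ : 0 < γ)
    (hV : IsPiecewiseHolderSnd γ V) (ω : ℝ) (hω : betaExponent ω = ⊤) :
    ∀ E : ℂ, ¬ IsSchrodingerEigenvalue V ω E := by
  lift γ to ℝ≥0 using hγ.le
  obtain ⟨M, hM⟩ := hV.bounded
  obtain ⟨K, hK⟩ := hV.exists_holderWith
  exact mainTheorem2_general hM (mod_cast hγ) hK hω
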